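/- Let $\Omega\subset\mathbb C$ be a nonempty bounded connected open set. Let $\mathcal C_b\Omega$ be the union of the bounded connected components of $\mathbb C\setminus\Omega$, let $\mathcal C_u\Omega$ be its unbounded connected component, and set $\mathcal S\Omega:=\mathbb C\setminus\mathcal C_u\Omega$. Suppose that $$\operatorname{dist}(\mathcal C_b\Omega,\mathcal C_u\Omega):=\inf\{|z-w| : z\in\mathcal C_b\Omega,\ w\in\mathcal C_u\Omega\}>0$$ (with the infimum understood as $+\infty$ if $\mathcal C_b\Omega=\emptyset$). Then every compact set $K\subset\mathcal S\Omega$ is encircled by $\Omega$, i.e. there exists a Jordan curve $\Gamma\subset\Omega$ such that $K$ is contained in the interior part of $\Gamma$ (the bounded connected component of $\mathbb C\setminus\Gamma$). -/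

import Mathlib

/-- `boundedCompl Ω` is the union of all bounded connected components of `ℂ ∖ Ω`. -/
def boundedCompl (Ω : Set ℂ) : Set ℂ :=
  {z | z ∈ Ωᶜ ∧ Bornology.IsBounded (connectedComponentIn Ωᶜ z)}

/-- `unboundedCompl Ω` is the union of all unbounded connected components of `ℂ ∖ Ω`. For a bounded
set `Ω` there is exactly one such component, since the complement of a large disc is connected. -/
def unboundedCompl (Ω : Set ℂ) : Set ℂ :=
  {z | z ∈ Ωᶜ ∧ ¬ Bornology.IsBounded (connectedComponentIn Ωᶜ z)}

/-- The filled set of `Ω`: the complement of the unbounded component of `ℂ ∖ Ω`. -/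
def filledSet (Ω : Set ℂ) : Set ℂ := (unboundedCompl Ω)ᶜ

/-- The distance between two subsets of the plane, with values in `[0, ∞]`; the distance to the
empty set is `∞`. -/
noncomputable def setEDist (A B : Set ℂ) : ENNReal := ⨅ z ∈ A, ⨅ w ∈ B, edist z w

/-- A Jordan curve: a homeomorphic image of the circle, that is, the image of a continuous injective
map from the (compact) circle into the plane. -/
def IsJordanCurve (Γ : Set ℂ) : Prop :=
  ∃ γ : Circle → ℂ, Continuous γ ∧ Function.Injective γ ∧ Set.range γ = Γ

/-- The interior part of a Jordan curve: the points of `ℂ ∖ Γ` whose connected component in `ℂ ∖ Γ`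
is bounded. -/
def jordanInterior (Γ : Set ℂ) : Set ℂ :=
  {z | z ∈ Γᶜ ∧ Bornology.IsBounded (connectedComponentIn Γᶜ z)}

/-- `K` is encircled by `Ω`: there is a Jordan curve in `Ω` whose interior part contains `K`. -/
def IsEncircledBy (K Ω : Set ℂ) : Prop :=
  ∃ Γ : Set ℂ, IsJordanCurve Γ ∧ Γ ⊆ Ω ∧ K ⊆ jordanInterior Γ

/-! Positive distance makes both parts of the complement closed. So the filled set is open, and it
is connected because the union of its components missing Ω would be clopen in the plane. Hence K
together with the bounded components lies in a connected compact L inside it. A Jordan curve around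
L that meets neither L nor the unbounded part X lies in Ω.

The curve is drawn on a square lattice so fine that no square meets both L and X. Let A be the
squares reached from L by edge-adjacent steps avoiding the squares that meet X. No vertex carries
exactly one boundary edge of A, so the finite boundary graph contains a cycle. Counting mod 2 the
vertical edges of the cycle to the left of a square gives a function that changes exactly across the
cycle (`leftParity_right`, `leftParity_up`). It is constant on A and, since X is connected, constant
off A; so the cycle uses every boundary edge (`mem_edges_of_leftParity_const`). The region filled by
A then has its frontier inside a single Jordan curve, and the Jordan curve theorem is not needed. -/

open Set

/-! ### Cycles in the boundary graph of a set of squares -/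

/-- A graph in which no edge ends in a leaf and whose edges live on a finite set of vertices
contains a cycle, as soon as it has an edge. -/
theorem exists_isCycle_of_no_leaf {V : Type*} {G : SimpleGraph V} {S : Set V} (hS : S.Finite)
    (hGS : ∀ a b, G.Adj a b → a ∈ S) (hleaf : ∀ a b, G.Adj a b → ∃ c, c ≠ b ∧ G.Adj a c)
    {a b : V} (hab : G.Adj a b) : ∃ (u : V) (p : G.Walk u u), p.IsCycle := by
  classical
  by_contra hcon
  push Not at hcon
  have hac : G.IsAcyclic := fun u p hp => hcon u p hp
  -- In an acyclic graph a path extends backwards past its start: a neighbour of the start other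
  -- than the second vertex cannot lie on the path. Arbitrarily long paths contradict finiteness of
  -- `S`.
  have key : ∀ n : ℕ, ∃ (u v : V) (p : G.Walk u v), p.IsPath ∧ p.length = n + 1 ∧
      ∀ x ∈ p.support, x ∈ S := by
    intro n
    induction n with
    | zero =>
      refine ⟨a, b, hab.toWalk, by simp [hab.ne], by simp, ?_⟩
      simp [hGS a b hab, hGS b a hab.symm]
    | succ n ih =>
      obtain ⟨u, v, p, hp, hl, hs⟩ := ih
      have hnil : ¬ p.Nil := by
        rw [← SimpleGraph.Walk.length_eq_zero_iff]; omega
      obtain ⟨c, hc, huc⟩ := hleaf u p.snd (p.adj_snd hnil)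
      refine ⟨c, v, SimpleGraph.Walk.cons huc.symm p, ?_, by simp [hl], ?_⟩
      · rw [SimpleGraph.Walk.cons_isPath_iff]
        exact ⟨hp, fun hcp => hc (hac.eq_snd_of_adj_start hp huc hcp)⟩
      · intro x hx
        rw [SimpleGraph.Walk.support_cons, List.mem_cons] at hx
        rcases hx with rfl | hx
        · exact hGS _ _ huc.symm
        · exact hs x hx
  obtain ⟨u, v, p, hp, hl, hs⟩ := key hS.toFinset.card
  have hsub : p.support.toFinset ⊆ hS.toFinset := by
    intro x hx
    simpa using hs x (by simpa using hx)
  have hcard := Finset.card_le_card hsub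
  rw [List.toFinset_card_of_nodup hp.support_nodup, SimpleGraph.Walk.length_support] at hcard
  omega

/-- Points of the integer lattice; also used for the unit square with this lower left corner. -/
abbrev GridPoint := ℤ × ℤ

/-- The lattice edge from `a` to `b`, going right or up, separates a square in `A` from a square
outside `A`. -/
def Separates (A : Set GridPoint) (a b : GridPoint) : Prop :=
  (b = (a.1 + 1, a.2) ∧ ¬ (a ∈ A ↔ (a.1, a.2 - 1) ∈ A)) ∨
  (b = (a.1, a.2 + 1) ∧ ¬ (a ∈ A ↔ (a.1 - 1, a.2) ∈ A))

/-- The graph formed by the lattice edges that separate a set of squares from its complement. -/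
def boundaryGraph (A : Set GridPoint) : SimpleGraph GridPoint := SimpleGraph.fromRel (Separates A)

theorem boundaryGraph_adj {A : Set GridPoint} {a b : GridPoint} :
    (boundaryGraph A).Adj a b ↔ Separates A a b ∨ Separates A b a := by
  rw [boundaryGraph, SimpleGraph.fromRel_adj]
  refine ⟨fun h => h.2, fun h => ⟨?_, h⟩⟩
  rintro rfl
  obtain ⟨x, y⟩ := a
  simp [Separates] at h

/-- Going once around a vertex through its four squares, membership in `A` changes an even number of
times, and the changes are the boundary edges at that vertex. -/
theorem boundaryGraph_no_leaf (A : Set GridPoint) (a b : GridPoint) (h : (boundaryGraph A).Adj a b) :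
    ∃ c, c ≠ b ∧ (boundaryGraph A).Adj a c := by
  obtain ⟨x, y⟩ := a
  have hr : (boundaryGraph A).Adj (x, y) (x + 1, y) ↔ ¬ ((x, y) ∈ A ↔ (x, y - 1) ∈ A) := by
    rw [boundaryGraph_adj]; simp [Separates]; grind
  have hu : (boundaryGraph A).Adj (x, y) (x, y + 1) ↔ ¬ ((x, y) ∈ A ↔ (x - 1, y) ∈ A) := by
    rw [boundaryGraph_adj]; simp [Separates]; grind
  have hl : (boundaryGraph A).Adj (x, y) (x - 1, y) ↔
      ¬ ((x - 1, y) ∈ A ↔ (x - 1, y - 1) ∈ A) := by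
    rw [boundaryGraph_adj]; simp [Separates]; grind
  have hd : (boundaryGraph A).Adj (x, y) (x, y - 1) ↔
      ¬ ((x, y - 1) ∈ A ↔ (x - 1, y - 1) ∈ A) := by
    rw [boundaryGraph_adj]; simp [Separates]; grind
  have hb : b = (x + 1, y) ∨ b = (x, y + 1) ∨ b = (x - 1, y) ∨ b = (x, y - 1) := by
    rw [boundaryGraph_adj] at h
    obtain ⟨z, w⟩ := b
    simp only [Separates, Prod.mk.injEq] at h ⊢
    omega
  by_contra hcon
  push Not at hcon
  have h1 := hcon (x + 1, y)
  have h2 := hcon (x, y + 1)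
  have h3 := hcon (x - 1, y)
  have h4 := hcon (x, y - 1)
  rw [hr] at h1
  rw [hu] at h2
  rw [hl] at h3
  rw [hd] at h4
  rcases hb with rfl | rfl | rfl | rfl
  · rw [hr] at h
    have e2 := h2 (by simp)
    have e3 := h3 (by simp; omega)
    have e4 := h4 (by simp)
    grind only
  · rw [hu] at h
    have e1 := h1 (by simp)
    have e3 := h3 (by simp)
    have e4 := h4 (by simp; omega)
    grind only
  · rw [hl] at h
    have e1 := h1 (by simp; omega)
    have e2 := h2 (by simp)
    have e4 := h4 (by simp)
    grind only
  · rw [hd] at h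
    have e1 := h1 (by simp)
    have e2 := h2 (by simp; omega)
    have e3 := h3 (by simp)
    grind only

theorem boundaryGraph_mem_finite {A : Set GridPoint} (hA : A.Finite) :
    {a | ∃ b, (boundaryGraph A).Adj a b}.Finite := by
  have hfin : ((fun q : GridPoint × GridPoint => q.1 + q.2) ''
      (A ×ˢ (Icc (0 : ℤ) 1 ×ˢ Icc (0 : ℤ) 1))).Finite :=
    (hA.prod ((finite_Icc _ _).prod (finite_Icc _ _))).image _
  refine hfin.subset ?_
  rintro ⟨x, y⟩ ⟨⟨z, w⟩, h⟩
  have h4 : (x, y) ∈ A ∨ (x - 1, y) ∈ A ∨ (x, y - 1) ∈ A ∨ (x - 1, y - 1) ∈ A := by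
    rw [boundaryGraph_adj] at h
    simp only [Separates, Prod.mk.injEq] at h
    grind
  rcases h4 with h | h | h | h
  · exact ⟨((x, y), (0, 0)), ⟨h, by simp⟩, by simp⟩
  · exact ⟨((x - 1, y), (1, 0)), ⟨h, by simp⟩, by simp⟩
  · exact ⟨((x, y - 1), (0, 1)), ⟨h, by simp⟩, by simp⟩
  · exact ⟨((x - 1, y - 1), (1, 1)), ⟨h, by simp⟩, by simp⟩

/-! ### Crossing parity of a lattice cycle -/

/-- Indicator of the vertical unit edges of row `j` with abscissa at most `m`. -/
def leftEdge (m j : ℤ) (a b : GridPoint) : ZMod 2 :=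
  if a.1 = b.1 ∧ a.1 ≤ m ∧ ((a.2 = j ∧ b.2 = j + 1) ∨ (b.2 = j ∧ a.2 = j + 1)) then 1 else 0

/-- The sum of a function of two vertices over the steps of a walk. -/
def walkSum {G : SimpleGraph GridPoint} {u v : GridPoint} (f : GridPoint → GridPoint → ZMod 2)
    (p : G.Walk u v) : ZMod 2 := (p.darts.map fun d => f d.fst d.snd).sum

/-- The parity of the number of steps of a walk that lie to the left of the square `s`. -/
def leftParity {G : SimpleGraph GridPoint} {u v : GridPoint} (p : G.Walk u v) (s : GridPoint) : ZMod 2 :=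
  walkSum (leftEdge s.1 s.2) p

section walkSum

variable {G : SimpleGraph GridPoint} {u v : GridPoint}

theorem walkSum_add (f g : GridPoint → GridPoint → ZMod 2) (p : G.Walk u v) :
    walkSum (fun a b => f a b + g a b) p = walkSum f p + walkSum g p := by
  simp [walkSum, List.sum_map_add]

theorem walkSum_congr {f g : GridPoint → GridPoint → ZMod 2} (p : G.Walk u v)
    (h : ∀ a b, G.Adj a b → f a b = g a b) : walkSum f p = walkSum g p := by
  unfold walkSum
  congr 1
  exact List.map_congr_left fun d _ => h _ _ d.adj

theorem walkSum_boundary (f : GridPoint → ZMod 2) (p : G.Walk u v) :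
    walkSum (fun a b => f a + f b) p = f u + f v := by
  induction p with
  | nil => simp [walkSum, CharTwo.add_self_eq_zero]
  | @cons a b c h p ih =>
    simp only [walkSum, SimpleGraph.Walk.darts_cons, List.map_cons, List.sum_cons] at ih ⊢
    rw [ih]
    linear_combination CharTwo.add_self_eq_zero (f b)

theorem walkSum_edge {p : G.Walk u v} (hp : p.IsTrail) (a b : GridPoint) :
    walkSum (fun c d => if s(c, d) = s(a, b) then 1 else 0) p =
      if s(a, b) ∈ p.edges then 1 else 0 := by
  have hcount : ∀ l : List (Sym2 GridPoint),
      (l.map fun e => if e = s(a, b) then (1 : ZMod 2) else 0).sum = (l.count s(a, b) : ZMod 2) := by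
    intro l
    induction l with
    | nil => simp
    | cons e l ih =>
      simp only [List.map_cons, List.sum_cons, ih, List.count_cons, beq_iff_eq]
      split_ifs <;> push_cast <;> ring
  have h := hcount p.edges
  have hfun : ((fun e => if e = s(a, b) then (1 : ZMod 2) else 0) ∘ SimpleGraph.Dart.edge) =
      fun d : G.Dart => if s(d.fst, d.snd) = s(a, b) then 1 else 0 := rfl
  rw [SimpleGraph.Walk.edges, List.map_map, hfun] at h
  unfold walkSum
  split_ifs with hm
  · have h1 := hp.count_edges_eq_one hm
    rw [SimpleGraph.Walk.edges] at h1
    rw [h1] at h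
    simpa using h
  · rw [SimpleGraph.Walk.edges] at hm
    rw [List.count_eq_zero_of_not_mem hm] at h
    simpa using h

variable {A : Set GridPoint}

/-- The two edge indicators differ only on the vertical edge between the squares, which a trail uses
at most once. -/
theorem leftParity_right {u : GridPoint} {p : (boundaryGraph A).Walk u u} (hp : p.IsTrail)
    (m j : ℤ) : leftParity p (m, j) + leftParity p (m - 1, j) =
      if s((m, j), (m, j + 1)) ∈ p.edges then 1 else 0 := by
  rw [← walkSum_edge hp, leftParity, leftParity, ← walkSum_add]
  refine walkSum_congr p ?_
  rintro ⟨x, y⟩ ⟨z, w⟩ h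
  simp only [leftEdge, Sym2.eq_iff, Prod.mk.injEq]
  split_ifs <;> first | omega | rfl

/-- The indicator of the lattice half-line ending at `(m, j)` has zero coboundary sum over a closed
walk. Adding it cancels the vertical edges of both rows and leaves the one horizontal edge that
exits the half-line. -/
theorem leftParity_up {u : GridPoint} {p : (boundaryGraph A).Walk u u} (hp : p.IsTrail)
    (m j : ℤ) : leftParity p (m, j) + leftParity p (m, j - 1) =
      if s((m, j), (m + 1, j)) ∈ p.edges then 1 else 0 := by
  have h0 := walkSum_boundary (fun a => if a.1 ≤ m ∧ a.2 = j then 1 else 0) p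
  rw [CharTwo.add_self_eq_zero] at h0
  rw [← walkSum_edge hp, leftParity, leftParity, ← walkSum_add]
  refine Eq.trans ?_ ((walkSum_add _ _ p).trans ((congrArg _ h0).trans (add_zero _)))
  refine walkSum_congr p ?_
  rintro ⟨x, y⟩ ⟨z, w⟩ h
  have hb : (z = x + 1 ∧ w = y) ∨ (z = x ∧ w = y + 1) ∨ (z = x - 1 ∧ w = y) ∨
      (z = x ∧ w = y - 1) := by
    rw [boundaryGraph_adj] at h
    simp only [Separates, Prod.mk.injEq] at h ⊢
    omega
  simp only [leftEdge, Sym2.eq_iff, Prod.mk.injEq]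
  split_ifs <;> first | omega | rfl

/-- A cycle in the boundary graph exhausts it, if the parity it defines is constant on both sides. -/
theorem mem_edges_of_leftParity_const {u : GridPoint} {p : (boundaryGraph A).Walk u u}
    (hp : p.IsCycle) (α β : ZMod 2) (hα : ∀ s ∈ A, leftParity p s = α)
    (hβ : ∀ s ∉ A, leftParity p s = β) {a b : GridPoint} (hab : (boundaryGraph A).Adj a b) :
    s(a, b) ∈ p.edges := by
  have key : ∀ a b, Separates A a b → (s(a, b) ∈ p.edges ↔ α + β = 1) := by
    rintro ⟨x, y⟩ b (⟨rfl, h⟩ | ⟨rfl, h⟩)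
    · have h1 := leftParity_up hp.isTrail x y
      have h2 : leftParity p (x, y) + leftParity p (x, y - 1) = α + β := by
        by_cases hA : (x, y) ∈ A
        · rw [hα _ hA, hβ _ (by tauto)]
        · rw [hβ _ hA, hα _ (by tauto), add_comm]
      rw [← h2, h1]
      simp
    · have h1 := leftParity_right hp.isTrail x y
      have h2 : leftParity p (x, y) + leftParity p (x - 1, y) = α + β := by
        by_cases hA : (x, y) ∈ A
        · rw [hα _ hA, hβ _ (by tauto)]
        · rw [hβ _ hA, hα _ (by tauto), add_comm]
      rw [← h2, h1]
      simp
  have key' : ∀ a b, (boundaryGraph A).Adj a b → (s(a, b) ∈ p.edges ↔ α + β = 1) := by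
    intro a b h
    rcases boundaryGraph_adj.1 h with h | h
    · exact key a b h
    · rw [Sym2.eq_swap]; exact key b a h
  -- The first edge of the cycle is itself a boundary edge, which forces `α + β = 1`.
  have hadj := p.adj_snd hp.not_nil
  have hmem : s(u, p.snd) ∈ p.edges := by
    have h3 := hp.three_le_length
    rw [SimpleGraph.Walk.mk_mem_edges_iff_exists]
    exact ⟨0, by omega, by simp⟩
  exact (key' a b hab).2 ((key' _ _ hadj).1 hmem)

end walkSum

/-! ### Lattice cycles as Jordan curves -/

/-- A lattice point as a complex number. -/
def gridPoint (a : GridPoint) : ℂ := ⟨a.1, a.2⟩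

/-- Two lattice points at distance one. -/
def UnitStep (a b : GridPoint) : Prop :=
  b = (a.1 + 1, a.2) ∨ b = (a.1, a.2 + 1) ∨ a = (b.1 + 1, b.2) ∨ a = (b.1, b.2 + 1)

theorem boundaryGraph_unitStep {A : Set GridPoint} {a b : GridPoint}
    (h : (boundaryGraph A).Adj a b) : UnitStep a b := by
  rw [boundaryGraph_adj] at h
  unfold Separates at h
  unfold UnitStep
  tauto

/-- The piecewise linear map with prescribed lattice values at the integers. -/
noncomputable def polyline (v : ℤ → GridPoint) (t : ℝ) : ℂ :=
  AffineMap.lineMap (gridPoint (v ⌊t⌋)) (gridPoint (v (⌊t⌋ + 1))) (Int.fract t)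

theorem polyline_eq_of_mem_Icc (v : ℤ → GridPoint) {k : ℤ} {t : ℝ} (ht : t ∈ Icc (k : ℝ) (k + 1)) :
    polyline v t = AffineMap.lineMap (gridPoint (v k)) (gridPoint (v (k + 1))) (t - k) := by
  rcases eq_or_lt_of_le ht.2 with h | h
  · have hf : ⌊t⌋ = k + 1 := by rw [h]; exact_mod_cast Int.floor_intCast (k + 1)
    rw [polyline, Int.fract, hf, h]
    simp
  · have hf : ⌊t⌋ = k := Int.floor_eq_iff.2 ⟨ht.1, h⟩
    rw [polyline, Int.fract, hf]

theorem continuous_polyline (v : ℤ → GridPoint) : Continuous (polyline v) := by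
  have hl : LocallyFinite fun k : ℤ => Icc (k : ℝ) (k + 1) :=
    locallyFinite_Icc_of_tendsto tendsto_intCast_atTop_atTop
      (Filter.tendsto_atBot_add_const_right _ _ ((tendsto_intCast_atBot_iff).2 Filter.tendsto_id))
  refine hl.continuous ?_ (fun _ => isClosed_Icc) fun k => ?_
  · exact eq_univ_of_forall fun t =>
      mem_iUnion.2 ⟨⌊t⌋, Int.floor_le t, (Int.lt_floor_add_one t).le⟩
  · refine ContinuousOn.congr (f := fun t : ℝ =>
      (AffineMap.lineMap (gridPoint (v k)) (gridPoint (v (k + 1))) (t - k) : ℂ)) ?_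
      fun t ht => polyline_eq_of_mem_Icc v ht
    exact (AffineMap.lineMap_continuous.comp (continuous_id.sub continuous_const)).continuousOn

theorem re_lineMap_gridPoint (a b : GridPoint) (s : ℝ) :
    (AffineMap.lineMap (gridPoint a) (gridPoint b) s : ℂ).re = a.1 + s * (b.1 - a.1) := by
  simp [AffineMap.lineMap_apply, gridPoint]; ring

theorem im_lineMap_gridPoint (a b : GridPoint) (s : ℝ) :
    (AffineMap.lineMap (gridPoint a) (gridPoint b) s : ℂ).im = a.2 + s * (b.2 - a.2) := by
  simp [AffineMap.lineMap_apply, gridPoint]; ring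

/-- Lattice edges meet only in common end points. -/
theorem lineMap_gridPoint_eq {a b c d : GridPoint} (hab : UnitStep a b) (hcd : UnitStep c d)
    {s t : ℝ} (hs : s ∈ Ico (0 : ℝ) 1) (ht : t ∈ Ico (0 : ℝ) 1)
    (h : (AffineMap.lineMap (gridPoint a) (gridPoint b) s : ℂ) =
      AffineMap.lineMap (gridPoint c) (gridPoint d) t) :
    (a = c ∧ s = t) ∨ (a = d ∧ b = c) := by
  have h1 := congrArg Complex.re h
  have h2 := congrArg Complex.im h
  rw [re_lineMap_gridPoint, re_lineMap_gridPoint] at h1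
  rw [im_lineMap_gridPoint, im_lineMap_gridPoint] at h2
  obtain ⟨hs0, hs1⟩ := hs
  obtain ⟨ht0, ht1⟩ := ht
  obtain ⟨a1, a2⟩ := a
  obtain ⟨b1, b2⟩ := b
  obtain ⟨c1, c2⟩ := c
  obtain ⟨d1, d2⟩ := d
  simp only [Prod.mk.injEq]
  -- Each point is less than one unit from the start of its edge, so the two starts differ by at
  -- most 1 in each coordinate; finitely many configurations remain.
  have near : ∀ x y : ℤ, (x : ℝ) - y < 2 → (y : ℝ) - x < 2 → x = y - 1 ∨ x = y ∨ x = y + 1 := by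
    intro x y hxy hyx
    have e1 : x - y < 2 := by exact_mod_cast hxy
    have e2 : y - x < 2 := by exact_mod_cast hyx
    omega
  have step : ∀ x1 x2 y1 y2 : ℤ, UnitStep (x1, x2) (y1, y2) →
      ((y1 : ℝ) - x1 = 1 ∧ (y2 : ℝ) - x2 = 0) ∨ ((y1 : ℝ) - x1 = 0 ∧ (y2 : ℝ) - x2 = 1) ∨
      ((y1 : ℝ) - x1 = -1 ∧ (y2 : ℝ) - x2 = 0) ∨ ((y1 : ℝ) - x1 = 0 ∧ (y2 : ℝ) - x2 = -1) := by
    intro x1 x2 y1 y2 hxy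
    simp only [UnitStep, Prod.mk.injEq] at hxy
    norm_cast
    omega
  have hb : ∀ x y : ℤ, (x : ℝ) = y → x = y := fun x y hxy => by exact_mod_cast hxy
  rcases step _ _ _ _ hab with ⟨e1, e2⟩ | ⟨e1, e2⟩ | ⟨e1, e2⟩ | ⟨e1, e2⟩ <;>
  rcases step _ _ _ _ hcd with ⟨f1, f2⟩ | ⟨f1, f2⟩ | ⟨f1, f2⟩ | ⟨f1, f2⟩ <;>
  rw [e1, f1] at h1 <;> rw [e2, f2] at h2 <;>
  rcases near a1 c1 (by linarith) (by linarith) with k1 | k1 | k1 <;>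
  rcases near a2 c2 (by linarith) (by linarith) with k2 | k2 | k2 <;>
  have k1' := congrArg (Int.cast : ℤ → ℝ) k1 <;>
  have k2' := congrArg (Int.cast : ℤ → ℝ) k2 <;>
  push_cast at k1' k2' <;>
  first
  | (exfalso; linarith)
  | exact Or.inl ⟨⟨k1, k2⟩, by linarith⟩
  | exact Or.inr ⟨⟨hb _ _ (by linarith), hb _ _ (by linarith)⟩,
      ⟨hb _ _ (by linarith), hb _ _ (by linarith)⟩⟩

/-- The union of the lattice edges of a walk. -/
def walkCurve {G : SimpleGraph GridPoint} {u v : GridPoint} (p : G.Walk u v) : Set ℂ :=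
  {z | ∃ a b, s(a, b) ∈ p.edges ∧ z ∈ segment ℝ (gridPoint a) (gridPoint b)}

theorem isJordanCurve_walkCurve {G : SimpleGraph GridPoint}
    (hG : ∀ a b, G.Adj a b → UnitStep a b) {u : GridPoint} {p : G.Walk u u} (hp : p.IsCycle) :
    IsJordanCurve (walkCurve p) := by
  have h3 := hp.three_le_length
  set n := p.length with hn
  -- Only the indices from 0 to `n` matter; the values elsewhere are junk.
  set v : ℤ → GridPoint := fun k => p.getVert k.toNat with hv
  have hvk : ∀ k : ℕ, v k = p.getVert k := fun k => by simp [hv]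
  have hvk1 : ∀ k : ℕ, v (k + 1) = p.getVert (k + 1) := fun k => by
    rw [← hvk]; push_cast; rfl
  have hn0 : (0 : ℝ) < n := by exact_mod_cast (by omega : 0 < n)
  have : Fact ((0 : ℝ) < n) := ⟨hn0⟩
  have hinj : ∀ i j : ℕ, i < n → j < n → p.getVert i = p.getVert j → i = j := fun i j hi hj h =>
    hp.getVert_injOn' (by simp only [mem_ofPred_eq]; omega) (by simp only [mem_ofPred_eq]; omega) h
  have hinj' : ∀ i j : ℕ, i < n → j < n → p.getVert (i + 1) = p.getVert j →
      i + 1 = j ∨ (i + 1 = n ∧ j = 0) := fun i j hi hj h => by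
    rcases (by omega : i + 1 < n ∨ i + 1 = n) with h' | h'
    · exact Or.inl (hinj _ _ h' hj h)
    · refine Or.inr ⟨h', (hinj 0 j (by omega) hj ?_).symm⟩
      rw [← h, h', hn, p.getVert_length, p.getVert_zero]
  have hfloor : ∀ t ∈ Ico (0 : ℝ) n, ∃ k : ℕ, k < n ∧ ⌊t⌋ = (k : ℤ) := fun t ht => by
    have h0 : 0 ≤ ⌊t⌋ := Int.floor_nonneg.2 ht.1
    have h1 : ⌊t⌋ < n := Int.floor_lt.2 (by exact_mod_cast ht.2)
    exact ⟨⌊t⌋.toNat, by omega, by omega⟩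
  have hInj : InjOn (polyline v) (Ico (0 : ℝ) n) := by
    intro s hs t ht hst
    obtain ⟨i, hi, hsi⟩ := hfloor s hs
    obtain ⟨j, hj, htj⟩ := hfloor t ht
    rw [polyline, polyline, hsi, htj, hvk, hvk, hvk1, hvk1] at hst
    rcases lineMap_gridPoint_eq (hG _ _ (p.adj_getVert_succ hi)) (hG _ _ (p.adj_getVert_succ hj))
      ⟨Int.fract_nonneg s, Int.fract_lt_one s⟩ ⟨Int.fract_nonneg t, Int.fract_lt_one t⟩ hst
      with ⟨h1, h2⟩ | ⟨h1, h2⟩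
    · have hij := hinj i j hi hj h1
      rw [← Int.floor_add_fract s, ← Int.floor_add_fract t, h2, hsi, htj, hij]
    · have e1 := hinj' i j hi hj h2
      have e2 := hinj' j i hj hi h1.symm
      omega
  have hcont : Continuous (AddCircle.liftIco (n : ℝ) 0 (polyline v)) := by
    refine AddCircle.liftIco_zero_continuous ?_ (continuous_polyline v).continuousOn
    have e0 : polyline v 0 = gridPoint (p.getVert 0) := by simp [polyline, hv]
    have e1 : polyline v n = gridPoint (p.getVert n) := by simp [polyline, hv]
    rw [e0, e1, hn, p.getVert_length, p.getVert_zero]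
  have hrange : range (AddCircle.liftIco (n : ℝ) 0 (polyline v)) = polyline v '' Ico (0 : ℝ) n := by
    rw [AddCircle.liftIco, EquivLike.range_comp, range_domRestrict, zero_add]
  refine ⟨AddCircle.liftIco (n : ℝ) 0 (polyline v) ∘ (AddCircle.homeomorphCircle hn0.ne').symm,
    hcont.comp (Homeomorph.continuous _), ?_, ?_⟩
  · refine Function.Injective.comp ?_ (Homeomorph.injective _)
    refine Function.Injective.comp ?_ (Equiv.injective _)
    rw [← injOn_iff_injective, zero_add]
    exact hInj
  · rw [EquivLike.range_comp, hrange]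
    ext z
    constructor
    · rintro ⟨t, ht, rfl⟩
      obtain ⟨k, hk, htk⟩ := hfloor t ht
      refine ⟨p.getVert k, p.getVert (k + 1), p.mk_mem_edges_iff_exists.2 ⟨k, hk, rfl⟩, ?_⟩
      rw [polyline, htk, hvk, hvk1, segment_eq_image_lineMap]
      exact ⟨_, ⟨Int.fract_nonneg t, (Int.fract_lt_one t).le⟩, rfl⟩
    · rintro ⟨a, b, hab, hz⟩
      obtain ⟨k, hk, hkab⟩ := p.mk_mem_edges_iff_exists.1 hab
      have hz' : z ∈ segment ℝ (gridPoint (v k)) (gridPoint (v (k + 1))) := by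
        rw [hvk, hvk1]
        rcases Sym2.eq_iff.1 hkab with ⟨rfl, rfl⟩ | ⟨rfl, rfl⟩
        · exact hz
        · rwa [segment_symm]
      rw [segment_eq_image_lineMap] at hz'
      obtain ⟨s, hs, rfl⟩ := hz'
      have hks : (k : ℝ) + s ∈ Icc (((k : ℕ) : ℤ) : ℝ) (((k : ℕ) : ℤ) + 1) := by
        push_cast; constructor <;> linarith [hs.1, hs.2]
      have hval := polyline_eq_of_mem_Icc v hks
      have hkn : (k : ℝ) + 1 ≤ n := by exact_mod_cast hk
      -- The parameter `n` is outside the half-open interval; its point is the base point, also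
      -- reached at 0.
      rcases eq_or_lt_of_le (show (k : ℝ) + s ≤ n by linarith [hs.2]) with h | h
      · refine ⟨0, ⟨le_rfl, hn0⟩, ?_⟩
        have e0 : polyline v 0 = gridPoint (p.getVert 0) := by simp [polyline, hv]
        have e1 : polyline v n = gridPoint (p.getVert n) := by simp [polyline, hv]
        rw [h, e1, hn, p.getVert_length] at hval
        rw [e0, p.getVert_zero, hval]
        congr 1
        push_cast
        linarith
      · refine ⟨k + s, ⟨by linarith [hs.1, (Nat.cast_nonneg k : (0 : ℝ) ≤ k)], h⟩, ?_⟩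
        rw [hval]
        congr 1
        push_cast
        ring

/-! ### Unit squares and their edges -/

/-- The closed unit square with lower left corner `s`. -/
def unitSquare (s : GridPoint) : Set ℂ :=
  {z | ((s.1 : ℝ) ≤ z.re ∧ z.re ≤ s.1 + 1) ∧ ((s.2 : ℝ) ≤ z.im ∧ z.im ≤ s.2 + 1)}

theorem isClosed_unitSquare (s : GridPoint) : IsClosed (unitSquare s) :=
  ((isClosed_le continuous_const Complex.continuous_re).inter
    (isClosed_le Complex.continuous_re continuous_const)).inter
    ((isClosed_le continuous_const Complex.continuous_im).inter
    (isClosed_le Complex.continuous_im continuous_const))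

theorem mem_unitSquare_floor (z : ℂ) : z ∈ unitSquare (⌊z.re⌋, ⌊z.im⌋) :=
  ⟨⟨Int.floor_le _, (Int.lt_floor_add_one _).le⟩, ⟨Int.floor_le _, (Int.lt_floor_add_one _).le⟩⟩

theorem gridPoint_mem_unitSquare (s : GridPoint) : gridPoint s ∈ unitSquare s := by
  simp [gridPoint, unitSquare]

theorem norm_sub_le_of_mem_unitSquare {s : GridPoint} {z w : ℂ} (hz : z ∈ unitSquare s)
    (hw : w ∈ unitSquare s) : ‖z - w‖ ≤ 2 := by
  obtain ⟨⟨h1, h2⟩, h3, h4⟩ := hz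
  obtain ⟨⟨k1, k2⟩, k3, k4⟩ := hw
  refine (Complex.norm_le_abs_re_add_abs_im _).trans ?_
  have e1 : |(z - w).re| ≤ 1 := by rw [Complex.sub_re, abs_le]; constructor <;> linarith
  have e2 : |(z - w).im| ≤ 1 := by rw [Complex.sub_im, abs_le]; constructor <;> linarith
  linarith

theorem locallyFinite_unitSquare : LocallyFinite unitSquare := by
  intro z
  refine ⟨Complex.re ⁻¹' Ioo (z.re - 1) (z.re + 1) ∩ Complex.im ⁻¹' Ioo (z.im - 1) (z.im + 1),
    Filter.inter_mem (Complex.continuous_re.continuousAt.preimage_mem_nhds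
      (Ioo_mem_nhds (by linarith) (by linarith)))
      (Complex.continuous_im.continuousAt.preimage_mem_nhds
      (Ioo_mem_nhds (by linarith) (by linarith))), ?_⟩
  refine ((finite_Icc (⌊z.re⌋ - 2) (⌊z.re⌋ + 2)).prod
    (finite_Icc (⌊z.im⌋ - 2) (⌊z.im⌋ + 2))).subset ?_
  rintro s ⟨w, ⟨⟨h1, h2⟩, h3, h4⟩, ⟨h5, h6⟩, h7, h8⟩
  have a1 := Int.floor_le z.re
  have a2 := Int.lt_floor_add_one z.re
  have b1 := Int.floor_le z.im
  have b2 := Int.lt_floor_add_one z.im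
  have key : ∀ m k : ℤ, ∀ x y : ℝ, (k : ℝ) ≤ x → x < k + 1 → x - 1 < y → y < x + 1 →
      (m : ℝ) ≤ y → y ≤ m + 1 → m ∈ Icc (k - 2) (k + 2) := by
    intro m k x y c1 c2 c3 c4 c5 c6
    have d1 : (k : ℝ) - 2 < m + 1 := by linarith
    have d2 : (m : ℝ) < k + 2 := by linarith
    have d1' : k - 2 < m + 1 := by exact_mod_cast d1
    have d2' : m < k + 2 := by exact_mod_cast d2
    exact ⟨by omega, by omega⟩
  exact ⟨key _ _ _ _ a1 a2 h5 h6 h1 h2, key _ _ _ _ b1 b2 h7 h8 h3 h4⟩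

theorem isClosed_biUnion_unitSquare (P : GridPoint → Prop) :
    IsClosed {z | ∃ s, P s ∧ z ∈ unitSquare s} := by
  have h := (locallyFinite_unitSquare.comp_injective
    (Subtype.val_injective (p := P))).isClosed_iUnion fun s => isClosed_unitSquare s.1
  convert! h using 1
  ext z
  simp

/-- If a property changes between two squares through `z`, then it changes between two such
squares that share an edge. -/
theorem exists_neighbours_of_mem {P : GridPoint → Prop} {z : ℂ} {s t : GridPoint}
    (hs : z ∈ unitSquare s) (ht : z ∈ unitSquare t) (hst : ¬ (P s ↔ P t)) :
    ∃ m j : ℤ, z ∈ unitSquare (m, j) ∧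
      ((z ∈ unitSquare (m - 1, j) ∧ ¬ (P (m, j) ↔ P (m - 1, j))) ∨
       (z ∈ unitSquare (m, j - 1) ∧ ¬ (P (m, j) ↔ P (m, j - 1)))) := by
  obtain ⟨a, b⟩ := s
  obtain ⟨c, d⟩ := t
  have near : ∀ (x y : ℤ) (r : ℝ), (x : ℝ) ≤ r → r ≤ y + 1 → x ≤ y + 1 := by
    intro x y r h1 h2
    exact_mod_cast h1.trans h2
  -- Squares are products, so `z` also lies in this mixed square, and `P` changes on one of the two
  -- legs through it.
  have hi : z ∈ unitSquare (a, d) := ⟨hs.1, ht.2⟩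
  by_cases h : P (a, b) ↔ P (a, d)
  · have h' : ¬ (P (a, d) ↔ P (c, d)) := by tauto
    have hne : a ≠ c := by rintro rfl; exact h' Iff.rfl
    have h1 := near a c _ hs.1.1 ht.1.2
    have h2 := near c a _ ht.1.1 hs.1.2
    rcases (by omega : c = a - 1 ∨ a = c - 1) with rfl | rfl
    · exact ⟨a, d, hi, Or.inl ⟨ht, h'⟩⟩
    · exact ⟨c, d, ht, Or.inl ⟨hi, by tauto⟩⟩
  · have hne : b ≠ d := by rintro rfl; exact h Iff.rfl
    have h1 := near b d _ hs.2.1 ht.2.2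
    have h2 := near d b _ ht.2.1 hs.2.2
    rcases (by omega : d = b - 1 ∨ b = d - 1) with rfl | rfl
    · exact ⟨a, b, hs, Or.inr ⟨hi, h⟩⟩
    · exact ⟨a, d, hi, Or.inr ⟨hs, by tauto⟩⟩

/-- With its horizontal analogue, this turns incidence with an edge into membership in the two
squares it bounds. -/
theorem mem_segment_gridPoint_up {m j : ℤ} {z : ℂ} :
    z ∈ segment ℝ (gridPoint (m, j)) (gridPoint (m, j + 1)) ↔
      z ∈ unitSquare (m, j) ∧ z ∈ unitSquare (m - 1, j) := by
  rw [segment_eq_image_lineMap]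
  constructor
  · rintro ⟨s, hs, rfl⟩
    simp only [unitSquare, mem_ofPred_eq, re_lineMap_gridPoint, im_lineMap_gridPoint]
    push_cast
    obtain ⟨h0, h1⟩ := hs
    refine ⟨⟨⟨?_, ?_⟩, ?_, ?_⟩, ⟨?_, ?_⟩, ?_, ?_⟩ <;> linarith
  · rintro ⟨⟨⟨h1, h2⟩, h3, h4⟩, ⟨h5, h6⟩, h7, h8⟩
    push_cast at *
    refine ⟨z.im - j, ⟨by linarith, by linarith⟩, Complex.ext ?_ ?_⟩
    · rw [re_lineMap_gridPoint]; push_cast; linarith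
    · rw [im_lineMap_gridPoint]; push_cast; linarith

theorem mem_segment_gridPoint_right {m j : ℤ} {z : ℂ} :
    z ∈ segment ℝ (gridPoint (m, j)) (gridPoint (m + 1, j)) ↔
      z ∈ unitSquare (m, j) ∧ z ∈ unitSquare (m, j - 1) := by
  rw [segment_eq_image_lineMap]
  constructor
  · rintro ⟨s, hs, rfl⟩
    simp only [unitSquare, mem_ofPred_eq, re_lineMap_gridPoint, im_lineMap_gridPoint]
    push_cast
    obtain ⟨h0, h1⟩ := hs
    refine ⟨⟨⟨?_, ?_⟩, ?_, ?_⟩, ⟨?_, ?_⟩, ?_, ?_⟩ <;> linarith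
  · rintro ⟨⟨⟨h1, h2⟩, h3, h4⟩, ⟨h5, h6⟩, h7, h8⟩
    push_cast at *
    refine ⟨z.re - m, ⟨by linarith, by linarith⟩, Complex.ext ?_ ?_⟩
    · rw [re_lineMap_gridPoint]; push_cast; linarith
    · rw [im_lineMap_gridPoint]; push_cast; linarith

theorem exists_adj_of_mem {A : Set GridPoint} {z : ℂ} {s t : GridPoint} (hs : z ∈ unitSquare s)
    (ht : z ∈ unitSquare t) (hsA : s ∈ A) (htA : t ∉ A) :
    ∃ a b, (boundaryGraph A).Adj a b ∧ z ∈ segment ℝ (gridPoint a) (gridPoint b) := by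
  obtain ⟨m, j, hz, ⟨hz', h⟩ | ⟨hz', h⟩⟩ :=
    exists_neighbours_of_mem (P := (· ∈ A)) hs ht (by tauto)
  · exact ⟨_, _, boundaryGraph_adj.2 (Or.inl (Or.inr ⟨rfl, h⟩)),
      mem_segment_gridPoint_up.2 ⟨hz, hz'⟩⟩
  · exact ⟨_, _, boundaryGraph_adj.2 (Or.inl (Or.inl ⟨rfl, h⟩)),
      mem_segment_gridPoint_right.2 ⟨hz, hz'⟩⟩

theorem exists_mem_of_adj {A : Set GridPoint} {a b : GridPoint} (hab : (boundaryGraph A).Adj a b)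
    {z : ℂ} (hz : z ∈ segment ℝ (gridPoint a) (gridPoint b)) :
    (∃ s ∈ A, z ∈ unitSquare s) ∧ ∃ t ∉ A, z ∈ unitSquare t := by
  wlog h : Separates A a b generalizing a b
  · exact this hab.symm (by rwa [segment_symm]) ((boundaryGraph_adj.1 hab).resolve_left h)
  obtain ⟨x, y⟩ := a
  rcases h with ⟨rfl, h⟩ | ⟨rfl, h⟩
  · obtain ⟨h1, h2⟩ := mem_segment_gridPoint_right.1 hz
    by_cases hA : (x, y) ∈ A
    · exact ⟨⟨_, hA, h1⟩, ⟨_, by tauto, h2⟩⟩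
    · exact ⟨⟨_, by tauto, h2⟩, ⟨_, hA, h1⟩⟩
  · obtain ⟨h1, h2⟩ := mem_segment_gridPoint_up.1 hz
    by_cases hA : (x, y) ∈ A
    · exact ⟨⟨_, hA, h1⟩, ⟨_, by tauto, h2⟩⟩
    · exact ⟨⟨_, by tauto, h2⟩, ⟨_, hA, h1⟩⟩

/-- A property of squares that does not change across edges meeting a connected set is constant on
the squares meeting that set. -/
theorem IsPreconnected.unitSquare_const {X : Set ℂ} (hX : IsPreconnected X) {P : GridPoint → Prop}
    (h : ∀ z ∈ X, ∀ m j : ℤ, z ∈ unitSquare (m, j) →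
      (z ∈ unitSquare (m - 1, j) → (P (m, j) ↔ P (m - 1, j))) ∧
      (z ∈ unitSquare (m, j - 1) → (P (m, j) ↔ P (m, j - 1))))
    {s t : GridPoint} (hs : (X ∩ unitSquare s).Nonempty) (ht : (X ∩ unitSquare t).Nonempty)
    (hPs : P s) : P t := by
  by_contra hPt
  obtain ⟨x, hxX, hx⟩ := hs
  obtain ⟨y, hyX, hy⟩ := ht
  -- The squares with `P` and those without have closed unions that cover the plane, so these unions
  -- meet on `X`.
  obtain ⟨z, hzX, ⟨a, hPa, hza⟩, b, hPb, hzb⟩ := isPreconnected_closed_iff.1 hX _ _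
    (isClosed_biUnion_unitSquare P) (isClosed_biUnion_unitSquare fun s => ¬ P s)
    (fun z _ => by
      by_cases hP : P (⌊z.re⌋, ⌊z.im⌋)
      · exact Or.inl ⟨_, hP, mem_unitSquare_floor z⟩
      · exact Or.inr ⟨_, hP, mem_unitSquare_floor z⟩)
    ⟨x, hxX, s, hPs, hx⟩ ⟨y, hyX, t, hPt, hy⟩
  obtain ⟨m, j, hz, ⟨hz', hne⟩ | ⟨hz', hne⟩⟩ :=
    exists_neighbours_of_mem (P := P) hza hzb (by tauto)
  · exact hne ((h z hzX m j hz).1 hz')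
  · exact hne ((h z hzX m j hz).2 hz')

theorem leftParity_eq_left {A : Set GridPoint} {u : GridPoint} {p : (boundaryGraph A).Walk u u}
    (hp : p.IsTrail) {m j : ℤ} (h : (m, j) ∈ A ↔ (m - 1, j) ∈ A) :
    leftParity p (m, j) = leftParity p (m - 1, j) := by
  have h1 := leftParity_right hp m j
  rw [if_neg, CharTwo.add_eq_zero] at h1
  · exact h1
  · intro hmem
    have hadj := p.adj_of_mem_edges hmem
    rw [boundaryGraph_adj] at hadj
    simp only [Separates, Prod.mk.injEq] at hadj
    grind

theorem leftParity_eq_down {A : Set GridPoint} {u : GridPoint} {p : (boundaryGraph A).Walk u u}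
    (hp : p.IsTrail) {m j : ℤ} (h : (m, j) ∈ A ↔ (m, j - 1) ∈ A) :
    leftParity p (m, j) = leftParity p (m, j - 1) := by
  have h1 := leftParity_up hp m j
  rw [if_neg, CharTwo.add_eq_zero] at h1
  · exact h1
  · intro hmem
    have hadj := p.adj_of_mem_edges hmem
    rw [boundaryGraph_adj] at hadj
    simp only [Separates, Prod.mk.injEq] at hadj
    grind

/-! ### Separation by a Jordan curve -/

/-- One step between edge-adjacent squares, ending outside `B`. -/
def AvoidingStep (B : Set GridPoint) (s t : GridPoint) : Prop :=
  t ∉ B ∧ (t = (s.1 + 1, s.2) ∨ t = (s.1 - 1, s.2) ∨ t = (s.1, s.2 + 1) ∨ t = (s.1, s.2 - 1))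

/-- A connected set `K` and a connected set `X` with bounded complement are separated by a Jordan
curve, if no unit square meets both of them. -/
theorem exists_isJordanCurve_separating {K X : Set ℂ} (hK : IsConnected K) (hX : IsPreconnected X)
    (hXb : Bornology.IsBounded Xᶜ)
    (hsep : ∀ s, (K ∩ unitSquare s).Nonempty → ¬ (X ∩ unitSquare s).Nonempty) :
    ∃ Γ U : Set ℂ, IsJordanCurve Γ ∧ IsOpen U ∧ Bornology.IsBounded U ∧ frontier U ⊆ Γ ∧ K ⊆ U ∧
      Disjoint Γ K ∧ Disjoint Γ X := by
  set B : Set GridPoint := {s | (X ∩ unitSquare s).Nonempty} with hB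
  obtain ⟨R, hR⟩ := hXb.exists_norm_le
  have hBfar : ∀ s ∉ B, |s.1| ≤ ⌊R⌋ ∧ |s.2| ≤ ⌊R⌋ := by
    intro s hs
    have hsX : gridPoint s ∈ Xᶜ := fun h => hs ⟨_, h, gridPoint_mem_unitSquare s⟩
    have h1 := (Complex.abs_re_le_norm _).trans (hR _ hsX)
    have h2 := (Complex.abs_im_le_norm _).trans (hR _ hsX)
    simp only [gridPoint] at h1 h2
    exact ⟨Int.le_floor.2 (by exact_mod_cast h1), Int.le_floor.2 (by exact_mod_cast h2)⟩
  have hBright : ∀ s : GridPoint, ∃ n : ℕ, (s.1 + n, s.2) ∈ B := by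
    intro s
    refine ⟨(⌊R⌋ - s.1 + 1).toNat, ?_⟩
    by_contra h
    have h1 := (abs_le.1 (hBfar _ h).1).2
    simp only at h1
    omega
  obtain ⟨k, hk⟩ := hK.nonempty
  set s₀ : GridPoint := (⌊k.re⌋, ⌊k.im⌋) with hs₀
  have hs₀K : (K ∩ unitSquare s₀).Nonempty := ⟨k, hk, mem_unitSquare_floor k⟩
  -- Reachability through edges, not corners, is what later makes the parity constant on `A`.
  set A : Set GridPoint := {t | Relation.ReflTransGen (AvoidingStep B) s₀ t} with hA
  have hs₀A : s₀ ∈ A := Relation.ReflTransGen.refl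
  have hstep : ∀ s ∈ A, ∀ t, AvoidingStep B s t → t ∈ A := fun s hs t hst =>
    Relation.ReflTransGen.tail hs hst
  have hAB : ∀ s ∈ A, s ∉ B := by
    intro s hs
    rcases Relation.ReflTransGen.cases_tail hs with rfl | ⟨t, -, ht⟩
    · exact hsep _ hs₀K
    · exact ht.1
  have hleft : ∀ m j, (m, j) ∉ B → (m - 1, j) ∉ B → ((m, j) ∈ A ↔ (m - 1, j) ∈ A) :=
    fun m j h1 h2 => ⟨fun h => hstep _ h _ ⟨h2, by simp⟩, fun h => hstep _ h _ ⟨h1, by simp⟩⟩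
  have hdown : ∀ m j, (m, j) ∉ B → (m, j - 1) ∉ B → ((m, j) ∈ A ↔ (m, j - 1) ∈ A) :=
    fun m j h1 h2 => ⟨fun h => hstep _ h _ ⟨h2, by simp⟩, fun h => hstep _ h _ ⟨h1, by simp⟩⟩
  have hKA : ∀ s, (K ∩ unitSquare s).Nonempty → s ∈ A := by
    intro s hs
    refine hK.isPreconnected.unitSquare_const (P := (· ∈ A)) ?_ hs₀K hs hs₀A
    intro z hz m j hm
    exact ⟨fun h => hleft _ _ (hsep _ ⟨z, hz, hm⟩) (hsep _ ⟨z, hz, h⟩),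
      fun h => hdown _ _ (hsep _ ⟨z, hz, hm⟩) (hsep _ ⟨z, hz, h⟩)⟩
  have hAfin : A.Finite := by
    refine ((finite_Icc (-⌊R⌋) ⌊R⌋).prod (finite_Icc (-⌊R⌋) ⌊R⌋)).subset fun s hs => ?_
    have h := hBfar s (hAB s hs)
    exact ⟨abs_le.1 h.1, abs_le.1 h.2⟩
  -- an edge of the boundary graph
  obtain ⟨a, b, hab⟩ : ∃ a b, (boundaryGraph A).Adj a b := by
    by_contra hcon
    push Not at hcon
    have hall : ∀ n : ℕ, (s₀.1 + n, s₀.2) ∈ A := by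
      intro n
      induction n with
      | zero => simpa using hs₀A
      | succ n ih =>
        by_contra hn
        refine hcon (s₀.1 + (n + 1 : ℕ), s₀.2) (s₀.1 + (n + 1 : ℕ), s₀.2 + 1)
          (boundaryGraph_adj.2 (Or.inl (Or.inr ⟨rfl, ?_⟩)))
        have he : s₀.1 + ((n + 1 : ℕ) : ℤ) - 1 = s₀.1 + n := by push_cast; ring
        simp only [he]
        tauto
    obtain ⟨n, hn⟩ := hBright s₀
    exact hAB _ (hall n) hn
  obtain ⟨u, p, hp⟩ := exists_isCycle_of_no_leaf (boundaryGraph_mem_finite hAfin)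
    (fun a b h => ⟨b, h⟩) (boundaryGraph_no_leaf A) hab
  have hα : ∀ s ∈ A, leftParity p s = leftParity p s₀ := by
    intro s hs
    induction hs with
    | refl => rfl
    | @tail t w ht hw ih =>
      have hwA : w ∈ A := hstep t ht w hw
      have htA : t ∈ A := ht
      obtain ⟨x, y⟩ := t
      rw [← ih]
      obtain ⟨-, rfl | rfl | rfl | rfl⟩ := hw
      · refine (leftParity_eq_left hp.isTrail (iff_of_true hwA ?_)).trans ?_
        · simpa only [add_sub_cancel_right] using htA
        · simp only [add_sub_cancel_right]
      · exact (leftParity_eq_left hp.isTrail (iff_of_true htA hwA)).symm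
      · refine (leftParity_eq_down hp.isTrail (iff_of_true hwA ?_)).trans ?_
        · simpa only [add_sub_cancel_right] using htA
        · simp only [add_sub_cancel_right]
      · exact (leftParity_eq_down hp.isTrail (iff_of_true htA hwA)).symm
  obtain ⟨n₁, hn₁⟩ := hBright s₀
  set s₁ : GridPoint := (s₀.1 + n₁, s₀.2) with hs₁
  have hβB : ∀ s ∈ B, leftParity p s = leftParity p s₁ := by
    intro s hs
    refine hX.unitSquare_const (P := fun s => leftParity p s = leftParity p s₁) ?_ hn₁ hs rfl
    intro z hz m j hm
    have hmA : (m, j) ∉ A := fun h => hAB _ h ⟨z, hz, hm⟩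
    constructor
    · intro h
      have hA' : (m - 1, j) ∉ A := fun h' => hAB _ h' ⟨z, hz, h⟩
      rw [leftParity_eq_left hp.isTrail (by tauto)]
    · intro h
      have hA' : (m, j - 1) ∉ A := fun h' => hAB _ h' ⟨z, hz, h⟩
      rw [leftParity_eq_down hp.isTrail (by tauto)]
  have hβ : ∀ s ∉ A, leftParity p s = leftParity p s₁ := by
    -- Walk right until `B` is reached: a square outside `B` with a neighbour in `A` would be in
    -- `A`, so the walk stays outside `A` and the parity does not change.
    have key : ∀ n : ℕ, ∀ x y : ℤ, (x, y) ∉ A → (x + n, y) ∈ B →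
        leftParity p (x, y) = leftParity p s₁ := by
      intro n
      induction n with
      | zero => exact fun x y _ h => hβB _ (by simpa using h)
      | succ n ih =>
        intro x y hxy h
        by_cases hxB : (x, y) ∈ B
        · exact hβB _ hxB
        · have h1 : (x + 1, y) ∉ A := fun h' =>
            hxy (hstep _ h' _ ⟨hxB, by simp⟩)
          rw [← ih (x + 1) y h1 (by convert! h using 2; push_cast; ring)]
          have h2 := leftParity_eq_left hp.isTrail (m := x + 1) (j := y)
            (iff_of_false h1 (by rwa [add_sub_cancel_right]))
          rw [h2, add_sub_cancel_right]
    rintro ⟨x, y⟩ hs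
    obtain ⟨n, hn⟩ := hBright (x, y)
    exact key n x y hs hn
  have hall := fun a b hab => mem_edges_of_leftParity_const (a := a) (b := b) hp _ _ hα hβ hab
  have hΓ : ∀ z ∈ walkCurve p, (∃ s ∈ A, z ∈ unitSquare s) ∧ ∃ t ∉ A, z ∈ unitSquare t := by
    rintro z ⟨a, b, hab, hz⟩
    exact exists_mem_of_adj (p.adj_of_mem_edges hab) hz
  -- `U` is the complement of the closed squares outside `A`, hence open; its closure lies in the
  -- squares of `A`, so its frontier consists of boundary edges, all on the cycle.
  refine ⟨walkCurve p, {z | ∃ s, s ∉ A ∧ z ∈ unitSquare s}ᶜ,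
    isJordanCurve_walkCurve (fun a b => boundaryGraph_unitStep) hp,
    (isClosed_biUnion_unitSquare _).isOpen_compl, ?_, ?_, ?_, ?_, ?_⟩
  · refine hXb.subset fun z hz hzX => hz ⟨(⌊z.re⌋, ⌊z.im⌋), ?_, mem_unitSquare_floor z⟩
    exact fun h => hAB _ h ⟨z, hzX, mem_unitSquare_floor z⟩
  · have hcl : closure {z | ∃ s, s ∉ A ∧ z ∈ unitSquare s}ᶜ ⊆ {z | ∃ s, s ∈ A ∧ z ∈ unitSquare s} := by
      refine closure_minimal (fun z hz => ?_) (isClosed_biUnion_unitSquare _)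
      refine ⟨(⌊z.re⌋, ⌊z.im⌋), ?_, mem_unitSquare_floor z⟩
      by_contra h
      exact hz ⟨_, h, mem_unitSquare_floor z⟩
    intro z hz
    rw [(isClosed_biUnion_unitSquare _).isOpen_compl.frontier_eq] at hz
    obtain ⟨s, hsA, hs⟩ := hcl hz.1
    obtain ⟨t, htA, ht⟩ := not_not.1 hz.2
    obtain ⟨a, b, hab, hzab⟩ := exists_adj_of_mem hs ht hsA htA
    exact ⟨a, b, hall a b hab, hzab⟩
  · rintro z hz ⟨s, hs, hzs⟩
    exact hs (hKA s ⟨z, hz, hzs⟩)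
  · rw [disjoint_left]
    intro z hz hzK
    obtain ⟨-, t, htA, ht⟩ := hΓ z hz
    exact htA (hKA t ⟨z, hzK, ht⟩)
  · rw [disjoint_left]
    intro z hz hzX
    obtain ⟨⟨s, hsA, hs⟩, -⟩ := hΓ z hz
    exact hAB s hsA ⟨z, hzX, hs⟩

/-- Dilation by `3 / δ` makes the distance at least 3, while two points of a unit square are at most
2 apart; the curve is then pulled back. -/
theorem exists_isJordanCurve_of_disjoint {K X : Set ℂ} (hK : IsConnected K) (hKc : IsCompact K)
    (hX : IsPreconnected X) (hXc : IsClosed X) (hXb : Bornology.IsBounded Xᶜ)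
    (hKX : Disjoint K X) :
    ∃ Γ U : Set ℂ, IsJordanCurve Γ ∧ IsOpen U ∧ Bornology.IsBounded U ∧ frontier U ⊆ Γ ∧ K ⊆ U ∧
      Disjoint Γ K ∧ Disjoint Γ X := by
  obtain ⟨δ, hδ, hdisj⟩ := hKX.exists_thickenings hKc hXc
  have hdist : ∀ x ∈ K, ∀ y ∈ X, δ ≤ ‖x - y‖ := by
    intro x hx y hy
    by_contra! h
    refine disjoint_left.1 hdisj (Metric.self_subset_thickening hδ K hx) ?_
    exact Metric.mem_thickening_iff.2 ⟨y, hy, by rwa [dist_eq_norm]⟩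
  have hc : ((3 / δ : ℝ) : ℂ) ≠ 0 := by
    rw [Complex.ofReal_ne_zero]; positivity
  set h := Homeomorph.mulLeft₀ ((3 / δ : ℝ) : ℂ) hc with hh
  have happ : ∀ z, h z = ((3 / δ : ℝ) : ℂ) * z := fun z => rfl
  have hbdd : ∀ s : Set ℂ, Bornology.IsBounded s → Bornology.IsBounded (h '' s) := fun s hs =>
    (hs.isCompact_closure.image h.continuous).isBounded.subset (image_mono subset_closure)
  have hbdd' : ∀ s : Set ℂ, Bornology.IsBounded s → Bornology.IsBounded (h ⁻¹' s) := fun s hs => by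
    have hcpt := (h.isCompact_preimage).2 hs.isCompact_closure
    exact hcpt.isBounded.subset (preimage_mono subset_closure)
  obtain ⟨Γ, U, ⟨γ, hγ, hγi, hγr⟩, hU, hUb, hUf, hKU, hΓK, hΓX⟩ :=
    exists_isJordanCurve_separating (K := h '' K) (X := h '' X) (hK.image h h.continuous.continuousOn)
    (hX.image h h.continuous.continuousOn) (by
      rw [← image_compl_eq h.bijective]; exact hbdd _ hXb) (by
      rintro s ⟨_, ⟨x, hx, rfl⟩, hxs⟩ ⟨_, ⟨y, hy, rfl⟩, hys⟩
      have h1 := norm_sub_le_of_mem_unitSquare hxs hys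
      rw [happ, happ, ← mul_sub, norm_mul, Complex.norm_real, Real.norm_of_nonneg (by positivity)]
        at h1
      have h2 := mul_le_mul_of_nonneg_left (hdist x hx y hy) (by positivity : 0 ≤ 3 / δ)
      rw [div_mul_cancel₀ _ hδ.ne'] at h2
      linarith)
  refine ⟨h ⁻¹' Γ, h ⁻¹' U, ⟨h.symm ∘ γ, h.symm.continuous.comp hγ, h.symm.injective.comp hγi, ?_⟩,
    hU.preimage h.continuous, hbdd' _ hUb, ?_, image_subset_iff.1 hKU, ?_, ?_⟩
  · rw [range_comp, hγr, h.image_symm]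
  · rw [← h.preimage_frontier]; exact preimage_mono hUf
  · exact disjoint_left.2 fun z hz hzK => disjoint_left.1 hΓK hz (mem_image_of_mem h hzK)
  · exact disjoint_left.2 fun z hz hzX => disjoint_left.1 hΓX hz (mem_image_of_mem h hzX)

/-! ### Connectedness in the plane and components of the complement -/

/-- A compact subset of a connected open set lies in a connected compact subset. -/
theorem IsCompact.exists_isConnected_superset {K S : Set ℂ} (hK : IsCompact K) (hS : IsOpen S)
    (hSc : IsConnected S) (hKS : K ⊆ S) :
    ∃ L, IsConnected L ∧ IsCompact L ∧ K ⊆ L ∧ L ⊆ S := by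
  obtain ⟨x₀, hx₀⟩ := hSc.nonempty
  have hpath := (hS.isConnected_iff_isPathConnected).1 hSc
  have key : ∃ L, x₀ ∈ L ∧ IsPreconnected L ∧ IsCompact L ∧ K ⊆ L ∧ L ⊆ S := by
    -- The common point `x₀` keeps unions of two such sets connected.
    refine hK.induction_on
      (p := fun s => ∃ L, x₀ ∈ L ∧ IsPreconnected L ∧ IsCompact L ∧ s ⊆ L ∧ L ⊆ S) ?_ ?_ ?_ ?_
    · exact ⟨{x₀}, rfl, isPreconnected_singleton, isCompact_singleton, empty_subset _,
        singleton_subset_iff.2 hx₀⟩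
    · rintro s t hst ⟨L, h1, h2, h3, h4, h5⟩
      exact ⟨L, h1, h2, h3, hst.trans h4, h5⟩
    · rintro s t ⟨L, h1, h2, h3, h4, h5⟩ ⟨M, k1, k2, k3, k4, k5⟩
      exact ⟨L ∪ M, Or.inl h1, h2.union x₀ h1 k1 k2, h3.union k3, union_subset_union h4 k4,
        union_subset h5 k5⟩
    · intro x hx
      obtain ⟨r, hr, hrS⟩ := Metric.nhds_basis_closedBall.mem_iff.1 (hS.mem_nhds (hKS hx))
      obtain ⟨γ, hγ⟩ := hpath.joinedIn x₀ hx₀ x (hKS hx)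
      refine ⟨Metric.closedBall x r, mem_nhdsWithin_of_mem_nhds (Metric.closedBall_mem_nhds x hr),
        range γ ∪ Metric.closedBall x r, Or.inl ⟨0, γ.source⟩, ?_, ?_, subset_union_right,
        union_subset (range_subset_iff.2 hγ) hrS⟩
      · exact (isPreconnected_range γ.continuous).union x ⟨1, γ.target⟩
          (Metric.mem_closedBall_self hr.le) (convex_closedBall x r).isPreconnected
      · exact (isCompact_range γ.continuous).union (isCompact_closedBall x r)
  obtain ⟨L, h1, h2, h3, h4, h5⟩ := key
  exact ⟨L, ⟨⟨x₀, h1⟩, h2⟩, h3, h4, h5⟩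

/-- The outside of a disc in the plane is connected. -/
theorem isPreconnected_norm_gt {R : ℝ} (hR : 0 ≤ R) : IsPreconnected {z : ℂ | R < ‖z‖} := by
  have h : {z : ℂ | R < ‖z‖} =
      (fun q : ℝ × ℝ => (q.1 : ℂ) * Complex.exp (q.2 * Complex.I)) '' (Ioi R ×ˢ univ) := by
    ext z
    constructor
    · exact fun hz => ⟨(‖z‖, z.arg), ⟨hz, trivial⟩, Complex.norm_mul_exp_arg_mul_I z⟩
    · rintro ⟨⟨r, θ⟩, ⟨hr, -⟩, rfl⟩
      simp only [mem_Ioi] at hr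
      simp only [mem_ofPred_eq, norm_mul, Complex.norm_exp_ofReal_mul_I, mul_one, Complex.norm_real,
        Real.norm_of_nonneg (hR.trans hr.le)]
      exact hr
  rw [h]
  refine (isPreconnected_Ioi.prod isPreconnected_univ).image _ (Continuous.continuousOn ?_)
  fun_prop

section components

variable {Ω : Set ℂ}

theorem boundedCompl_union_unboundedCompl (Ω : Set ℂ) :
    boundedCompl Ω ∪ unboundedCompl Ω = Ωᶜ := by
  ext z
  simp only [boundedCompl, unboundedCompl, mem_union, mem_ofPred_eq]
  tauto

theorem exists_norm_gt_subset_unboundedCompl (hbdd : Bornology.IsBounded Ω) :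
    ∃ R : ℝ, 0 ≤ R ∧ {z : ℂ | R < ‖z‖} ⊆ unboundedCompl Ω := by
  obtain ⟨R, hR0, hR⟩ := hbdd.exists_pos_norm_le
  refine ⟨R, hR0.le, fun z hz => ?_⟩
  have hsub : {z : ℂ | R < ‖z‖} ⊆ Ωᶜ := fun w hw h => absurd (hR w h) (not_le.2 hw)
  refine ⟨hsub hz, fun hb => ?_⟩
  have hb' := hb.subset ((isPreconnected_norm_gt hR0.le).subset_connectedComponentIn hz hsub)
  obtain ⟨C, hC⟩ := hb'.exists_norm_le
  have hpos : 0 ≤ |R| + |C| + 1 := by positivity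
  have h1 : ‖((|R| + |C| + 1 : ℝ) : ℂ)‖ = |R| + |C| + 1 := by
    rw [Complex.norm_real, Real.norm_of_nonneg hpos]
  have h2 := hC ((|R| + |C| + 1 : ℝ) : ℂ) (by
    rw [mem_ofPred_eq, h1]; linarith [le_abs_self R, abs_nonneg C])
  rw [h1] at h2
  linarith [le_abs_self C, abs_nonneg R]

/-- Every unbounded component reaches the outside of a large disc, which is connected and misses
`Ω`, so there is only one. -/
theorem isPreconnected_unboundedCompl (hbdd : Bornology.IsBounded Ω) :
    IsPreconnected (unboundedCompl Ω) := by
  obtain ⟨R, hR0, hR⟩ := exists_norm_gt_subset_unboundedCompl hbdd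
  have hE := isPreconnected_norm_gt hR0
  have hsub : {z : ℂ | R < ‖z‖} ⊆ Ωᶜ := fun z hz => (hR hz).1
  refine isPreconnected_of_forall_pair fun z hz w hw => ?_
  have hout : ∀ z ∈ unboundedCompl Ω, ∃ y ∈ connectedComponentIn Ωᶜ z, R < ‖y‖ := by
    intro z hz
    by_contra! h
    exact hz.2 (isBounded_iff_forall_norm_le.2 ⟨R, h⟩)
  obtain ⟨x, hxz, hx⟩ := hout z hz
  obtain ⟨y, hyw, hy⟩ := hout w hw
  have h1 := connectedComponentIn_eq hxz
  have h2 := connectedComponentIn_eq hyw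
  have h3 := connectedComponentIn_eq (hE.subset_connectedComponentIn hx hsub hy)
  refine ⟨connectedComponentIn Ωᶜ z, fun v hv => ?_, mem_connectedComponentIn hz.1, ?_,
    isPreconnected_connectedComponentIn⟩
  · refine ⟨connectedComponentIn_subset _ _ hv, ?_⟩
    rw [← connectedComponentIn_eq hv]
    exact hz.2
  · rw [h1, h3, ← h2]
    exact mem_connectedComponentIn hw.1

/-- A limit point of `A` lying in `B` would put the two sets at distance zero. -/
theorem isClosed_of_setEDist_pos {A B : Set ℂ} (hAB : IsClosed (A ∪ B)) (h : 0 < setEDist A B) :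
    IsClosed A := by
  refine isClosed_of_closure_subset fun z hz => ?_
  refine (closure_minimal subset_union_left hAB hz).resolve_right fun hzB => ?_
  obtain ⟨w, hw, hwz⟩ := EMetric.mem_closure_iff.1 hz _ h
  rw [edist_comm] at hwz
  exact absurd ((iInf₂_le w hw).trans (iInf₂_le z hzB)) (not_le.2 hwz)

theorem setEDist_comm (A B : Set ℂ) : setEDist A B = setEDist B A := by
  unfold setEDist
  rw [iInf₂_comm]
  simp only [edist_comm]

theorem filledSet_eq (Ω : Set ℂ) : filledSet Ω = Ω ∪ boundedCompl Ω := by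
  ext z
  simp only [filledSet, boundedCompl, unboundedCompl, mem_union, mem_compl_iff, mem_ofPred_eq]
  tauto

theorem isBounded_filledSet (hbdd : Bornology.IsBounded Ω) : Bornology.IsBounded (filledSet Ω) := by
  obtain ⟨R, -, hR⟩ := exists_norm_gt_subset_unboundedCompl hbdd
  exact isBounded_iff_forall_norm_le.2 ⟨R, fun z hz => not_lt.1 fun h => hz (hR h)⟩

theorem isConnected_filledSet (hconn : IsConnected Ω) (hb : IsClosed (boundedCompl Ω))
    (hu : IsClosed (unboundedCompl Ω)) : IsConnected (filledSet Ω) := by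
  obtain ⟨x₀, hx₀⟩ := hconn.nonempty
  have hS : IsOpen (filledSet Ω) := hu.isOpen_compl
  have hΩS : Ω ⊆ filledSet Ω := by rw [filledSet_eq]; exact subset_union_left
  have key : filledSet Ω ⊆ connectedComponentIn (filledSet Ω) x₀ := by
    set W := connectedComponentIn (filledSet Ω) x₀ with hW
    have hΩW : Ω ⊆ W := hconn.isPreconnected.subset_connectedComponentIn hx₀ hΩS
    have hV : filledSet Ω \ W ⊆ boundedCompl Ω := fun z hz => by
      have h := hz.1
      rw [filledSet_eq] at h
      exact h.resolve_left fun h' => hz.2 (hΩW h')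
    have hVopen : IsOpen (filledSet Ω \ W) := by
      rw [isOpen_iff_forall_mem_open]
      intro z hz
      refine ⟨connectedComponentIn (filledSet Ω) z, fun y hy => ?_, hS.connectedComponentIn,
        mem_connectedComponentIn hz.1⟩
      refine ⟨connectedComponentIn_subset _ _ hy, fun hyW => hz.2 ?_⟩
      rw [hW, connectedComponentIn_eq hyW, ← connectedComponentIn_eq hy]
      exact mem_connectedComponentIn hz.1
    -- Limit points stay in `boundedCompl Ω`, hence in the filled set, and the open component `W`
    -- cannot contain them.
    have hVclosed : IsClosed (filledSet Ω \ W) := by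
      refine isClosed_of_closure_subset fun z hz => ?_
      have hzb := closure_minimal hV hb hz
      refine ⟨by rw [filledSet_eq]; exact Or.inr hzb, fun hzW => ?_⟩
      obtain ⟨y, hyW, hy⟩ := mem_closure_iff.1 hz W hS.connectedComponentIn hzW
      exact hy.2 hyW
    rcases isClopen_iff.1 ⟨hVclosed, hVopen⟩ with h | h
    · exact sdiff_eq_empty.1 h
    · have hmem : x₀ ∈ filledSet Ω \ W := by rw [h]; trivial
      exact absurd (mem_connectedComponentIn (hΩS hx₀)) hmem.2
  refine ⟨⟨x₀, hΩS hx₀⟩, ?_⟩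
  rw [key.antisymm (connectedComponentIn_subset _ _)]
  exact isPreconnected_connectedComponentIn

end components

/-! ### The encircling curve -/

theorem mainTheorem7 (Ω : Set ℂ) (hopen : IsOpen Ω) (hconn : IsConnected Ω)
    (hbdd : Bornology.IsBounded Ω)
    (hdist : 0 < setEDist (boundedCompl Ω) (unboundedCompl Ω))
    (K : Set ℂ) (hK : IsCompact K) (hKΩ : K ⊆ filledSet Ω) :
    IsEncircledBy K Ω := by
  have hunion : IsClosed (boundedCompl Ω ∪ unboundedCompl Ω) := by
    rw [boundedCompl_union_unboundedCompl]; exact hopen.isClosed_compl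
  have hb : IsClosed (boundedCompl Ω) := isClosed_of_setEDist_pos hunion hdist
  have hu : IsClosed (unboundedCompl Ω) :=
    isClosed_of_setEDist_pos (by rwa [union_comm]) (by rwa [setEDist_comm])
  have hSb : Bornology.IsBounded (filledSet Ω) := isBounded_filledSet hbdd
  have hbS : boundedCompl Ω ⊆ filledSet Ω := by rw [filledSet_eq]; exact subset_union_right
  have hbc : IsCompact (boundedCompl Ω) := Metric.isCompact_of_isClosed_isBounded hb (hSb.subset hbS)
  -- Including the bounded components in `L` keeps the curve off them, which places it in `Ω`.
  obtain ⟨L, hLconn, hLc, hKL, hLS⟩ := (hK.union hbc).exists_isConnected_superset hu.isOpen_compl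
    (isConnected_filledSet hconn hb hu) (union_subset hKΩ hbS)
  obtain ⟨Γ, U, hΓ, hU, hUb, hUf, hLU, hΓL, hΓX⟩ := exists_isJordanCurve_of_disjoint hLconn hLc
    (isPreconnected_unboundedCompl hbdd) hu hSb (disjoint_left.2 fun z hz => hLS hz)
  refine ⟨Γ, hΓ, fun z hz => ?_, fun z hz => ?_⟩
  · have hzS : z ∈ filledSet Ω := fun h => disjoint_left.1 hΓX hz h
    rw [filledSet_eq] at hzS
    exact hzS.resolve_right fun h => disjoint_left.1 hΓL hz (hKL (Or.inr h))
  · have hzL : z ∈ L := hKL (Or.inl hz)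
    have hzΓ : z ∈ Γᶜ := fun h => disjoint_left.1 hΓL h hzL
    refine ⟨hzΓ, hUb.subset ?_⟩
    -- The component meets `U` and avoids `Γ`, hence the frontier of `U`, so it cannot leave the
    -- bounded set `U`.
    refine isPreconnected_connectedComponentIn.subset_of_closure_inter_subset hU
      ⟨z, mem_connectedComponentIn hzΓ, hLU hzL⟩ fun w hw => ?_
    by_contra hwU
    refine connectedComponentIn_subset _ _ hw.2 (hUf ?_)
    rw [hU.frontier_eq]
    exact ⟨hw.1, hwU⟩
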